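/- Let $M$ be a complex reductive monoid with zero, that is, an irreducible affine algebraic monoid over $\mathbb{C}$ (an affine variety with an associative multiplication $M\times M\to M$ that is a morphism of varieties and has a unit) which has a zero element $0$ and whose unit group $G$ is a connected reductive algebraic group. Let $B$ be a Borel subgroup of $G$ (a maximal closed connected solvable subgroup), let $\overline{B}$ be the Zariski closure of $B$ in $M$, and put $$\overline{B}^{nil} := \{\, x\in \overline{B} : x^m = 0 \text{ for some integer } m\geq 1 \,\}.$$ Then $\overline{B}^{nil}$ is an algebraic subsemigroup of $M$, that is, it is Zariski closed in $M$ and $xy\in \overline{B}^{nil}$ for all $x,y\in\overline{B}^{nil}$. Moreover it is $B\times B$-stable: $b_1 x b_2^{-1}\in \overline{B}^{nil}$ for all $b_1,b_2\in B$ and $x\in\overline{B}^{nil}$. -/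

import Mathlib

open scoped Topology

/-- An affine variety over `K` (meant for `K` algebraically closed) with underlying set of points
`X`, given by its algebra of regular functions: a finitely generated algebra of `K`-valued functions
on `X` such that the points of `X` are exactly the `K`-algebra homomorphisms to `K`. -/
structure AffineVariety (K : Type*) [Field K] (X : Type*) where
  /-- The coordinate algebra `K[X]`. -/
  coord : Subalgebra K (X → K)
  fg : coord.FG
  eval_injective : ∀ x y : X, (∀ f ∈ coord, f x = f y) → x = y
  eval_surjective : ∀ φ : coord →ₐ[K] K, ∃ x : X, ∀ f : coord, φ f = (f : X → K) x

namespace AffineVariety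

variable {K : Type*} [Field K] {X Y : Type*}

/-- The common zeros of a set of functions. -/
def zeros (F : Set (X → K)) : Set X := {x | ∀ f ∈ F, f x = 0}

/-- The Zariski topology: the closed sets are the common zero sets of regular functions. -/
@[reducible] def zariski (A : AffineVariety K X) : TopologicalSpace X :=
  TopologicalSpace.ofClosed {S | ∃ F : Set (X → K), F ⊆ A.coord ∧ S = zeros F}
    ⟨{1}, by simp, by ext; simp [zeros]⟩
    (by
      intro 𝒮 h𝒮
      refine ⟨{f | f ∈ A.coord ∧ ∃ S ∈ 𝒮, ∀ x ∈ S, f x = 0}, fun f hf => hf.1, ?_⟩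
      ext x
      constructor
      · rintro hx f ⟨-, S, hS, hf⟩
        exact hf x (hx S hS)
      · intro hx S hS
        obtain ⟨F, hF, rfl⟩ := h𝒮 hS
        exact fun f hf => hx f ⟨hF hf, _, hS, fun y hy => hy f hf⟩)
    (by
      rintro _ ⟨F, hF, rfl⟩ _ ⟨F', hF', rfl⟩
      refine ⟨{h | ∃ f ∈ F, ∃ f' ∈ F', h = f * f'}, ?_, ?_⟩
      · rintro _ ⟨f, hf, f', hf', rfl⟩
        exact A.coord.mul_mem (hF hf) (hF' hf')
      · ext x
        constructor
        · rintro (hx | hx) _ ⟨f, hf, f', hf', rfl⟩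
          · simp [hx f hf]
          · simp [hx f' hf']
        · intro hx
          by_contra hcon
          simp only [Set.mem_union, not_or, zeros, Set.mem_ofPred_eq, not_forall] at hcon
          obtain ⟨⟨f, hf, hfx⟩, f', hf', hfx'⟩ := hcon
          exact mul_ne_zero hfx hfx' (hx _ ⟨f, hf, f', hf', rfl⟩))

/-- The coordinate algebra of the product variety `X × Y`, that is `K[X] ⊗ K[Y]` as an algebra of
functions. -/
def prodCoord (A : AffineVariety K X) (A' : AffineVariety K Y) : Subalgebra K (X × Y → K) :=
  Algebra.adjoin K
    ({F | ∃ f ∈ A.coord, F = fun p => f p.1} ∪ {F | ∃ f ∈ A'.coord, F = fun p => f p.2})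

end AffineVariety

/-- An affine (equivalently, linear) algebraic monoid structure on the monoid `M`: an affine variety
structure on `M` for which the multiplication `M × M → M` is a morphism of varieties. -/
structure AffineMonoid (K : Type*) [Field K] (M : Type*) [Monoid M] extends
    AffineVariety K M where
  mul_regular : ∀ f ∈ coord,
    (fun p : M × M => f (p.1 * p.2)) ∈ toAffineVariety.prodCoord toAffineVariety

/-- An affine algebraic group structure on the group `G`. -/
structure AffineGroup (K : Type*) [Field K] (G : Type*) [Group G] extends AffineMonoid K G where
  inv_regular : ∀ f ∈ coord, (fun g : G => f g⁻¹) ∈ coord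

namespace AffineMonoid

variable {K : Type*} [Field K] {M : Type*} [Monoid M]

/-- The coordinate algebra of the unit group: the functions on `Mˣ` induced by the embedding
`g ↦ (g, g⁻¹)` of `Mˣ` as the closed subset `{(x, y) | x y = y x = 1}` of `M × M`. -/
def unitsCoord (A : AffineMonoid K M) : Subalgebra K (Mˣ → K) :=
  Algebra.adjoin K
    ({F | ∃ f ∈ A.coord, F = fun g : Mˣ => f g} ∪
      {F | ∃ f ∈ A.coord, F = fun g : Mˣ => f (g⁻¹ : Mˣ)})

theorem diag_mem_unitsCoord (A : AffineMonoid K M) {F : M × M → K}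
    (hF : F ∈ A.prodCoord A.toAffineVariety) :
    (fun g : Mˣ => F ((g : M), ((g⁻¹ : Mˣ) : M))) ∈ A.unitsCoord := by
  induction hF using Algebra.adjoin_induction with
  | mem F hF =>
    rcases hF with ⟨f, hf, rfl⟩ | ⟨f, hf, rfl⟩
    · exact Algebra.subset_adjoin (Or.inl ⟨f, hf, rfl⟩)
    · exact Algebra.subset_adjoin (Or.inr ⟨f, hf, rfl⟩)
  | algebraMap r => exact A.unitsCoord.algebraMap_mem r
  | add _ _ _ _ h h' => exact A.unitsCoord.add_mem h h'
  | mul _ _ _ _ h h' => exact A.unitsCoord.mul_mem h h'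

theorem mul_mem_of_mem_unitsCoord (A : AffineMonoid K M) {P : Subalgebra K (Mˣ × Mˣ → K)}
    (hP : ∀ F ∈ A.unitsCoord, (fun p : Mˣ × Mˣ => F p.1) ∈ P ∧ (fun p : Mˣ × Mˣ => F p.2) ∈ P)
    {F : Mˣ → K} (hF : F ∈ A.unitsCoord) : (fun p : Mˣ × Mˣ => F (p.1 * p.2)) ∈ P := by
  have key : ∀ H ∈ A.prodCoord A.toAffineVariety,
      (fun p : Mˣ × Mˣ => H ((p.1 : M), (p.2 : M))) ∈ P ∧
      (fun p : Mˣ × Mˣ => H (((p.2⁻¹ : Mˣ) : M), ((p.1⁻¹ : Mˣ) : M))) ∈ P := by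
    intro H hH
    induction hH using Algebra.adjoin_induction with
    | mem H hH =>
      rcases hH with ⟨f, hf, rfl⟩ | ⟨f, hf, rfl⟩
      · exact ⟨(hP _ (Algebra.subset_adjoin (Or.inl ⟨f, hf, rfl⟩))).1,
          (hP _ (Algebra.subset_adjoin (Or.inr ⟨f, hf, rfl⟩))).2⟩
      · exact ⟨(hP _ (Algebra.subset_adjoin (Or.inl ⟨f, hf, rfl⟩))).2,
          (hP _ (Algebra.subset_adjoin (Or.inr ⟨f, hf, rfl⟩))).1⟩
    | algebraMap r => exact ⟨P.algebraMap_mem r, P.algebraMap_mem r⟩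
    | add _ _ _ _ h h' => exact ⟨P.add_mem h.1 h'.1, P.add_mem h.2 h'.2⟩
    | mul _ _ _ _ h h' => exact ⟨P.mul_mem h.1 h'.1, P.mul_mem h.2 h'.2⟩
  induction hF using Algebra.adjoin_induction with
  | mem F hF =>
    rcases hF with ⟨f, hf, rfl⟩ | ⟨f, hf, rfl⟩
    · simpa using (key _ (A.mul_regular f hf)).1
    · simpa using (key _ (A.mul_regular f hf)).2
  | algebraMap r => exact P.algebraMap_mem r
  | add _ _ _ _ h h' => exact P.add_mem h h'
  | mul _ _ _ _ h h' => exact P.mul_mem h h'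

theorem unitsCoord_fg (A : AffineMonoid K M) : A.unitsCoord.FG := by
  let φ : (M → K) →ₐ[K] (Mˣ → K) := AlgHom.pi fun g => Pi.evalAlgHom K (fun _ => K) (g : M)
  let ψ : (M → K) →ₐ[K] (Mˣ → K) :=
    AlgHom.pi fun g => Pi.evalAlgHom K (fun _ => K) ((g⁻¹ : Mˣ) : M)
  have h : A.unitsCoord = A.coord.map φ ⊔ A.coord.map ψ := by
    rw [← Algebra.adjoin_eq (A.coord.map φ), ← Algebra.adjoin_eq (A.coord.map ψ),
      ← Algebra.adjoin_union]
    refine congrArg (Algebra.adjoin K) (congrArg₂ (· ∪ ·) ?_ ?_) <;>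
    · ext F
      constructor
      · rintro ⟨f, hf, rfl⟩
        exact ⟨f, hf, rfl⟩
      · rintro ⟨f, hf, rfl⟩
        exact ⟨f, hf, rfl⟩
  rw [h]
  exact (A.fg.map φ).sup (A.fg.map ψ)

theorem exists_unit_of_algHom (A : AffineMonoid K M) (φ : A.unitsCoord →ₐ[K] K) :
    ∃ g : Mˣ, ∀ F : A.unitsCoord, φ F = (F : Mˣ → K) g := by
  let i₁ : A.coord →ₐ[K] A.unitsCoord :=
    ((AlgHom.pi fun g : Mˣ => Pi.evalAlgHom K (fun _ => K) (g : M)).comp A.coord.val).codRestrict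
      A.unitsCoord fun f => Algebra.subset_adjoin (Or.inl ⟨f, f.2, rfl⟩)
  let i₂ : A.coord →ₐ[K] A.unitsCoord :=
    ((AlgHom.pi fun g : Mˣ => Pi.evalAlgHom K (fun _ => K) ((g⁻¹ : Mˣ) : M)).comp
      A.coord.val).codRestrict
      A.unitsCoord fun f => Algebra.subset_adjoin (Or.inr ⟨f, f.2, rfl⟩)
  obtain ⟨x, hx⟩ := A.eval_surjective (φ.comp i₁)
  obtain ⟨y, hy⟩ := A.eval_surjective (φ.comp i₂)
  have key : ∀ H (hH : H ∈ A.prodCoord A.toAffineVariety),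
      φ ⟨_, A.diag_mem_unitsCoord hH⟩ = H (x, y) := by
    intro H hH
    induction hH using Algebra.adjoin_induction with
    | mem H hH =>
      rcases hH with ⟨f, hf, rfl⟩ | ⟨f, hf, rfl⟩
      · exact hx ⟨f, hf⟩
      · exact hy ⟨f, hf⟩
    | algebraMap r => exact φ.commutes r
    | add u v hu hv h h' =>
      exact (map_add φ ⟨_, A.diag_mem_unitsCoord hu⟩ ⟨_, A.diag_mem_unitsCoord hv⟩).trans
        (congrArg₂ (· + ·) h h')
    | mul u v hu hv h h' =>
      exact (map_mul φ ⟨_, A.diag_mem_unitsCoord hu⟩ ⟨_, A.diag_mem_unitsCoord hv⟩).trans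
        (congrArg₂ (· * ·) h h')
  have swap : ∀ H ∈ A.prodCoord A.toAffineVariety,
      (fun p : M × M => H (p.2, p.1)) ∈ A.prodCoord A.toAffineVariety := by
    intro H hH
    induction hH using Algebra.adjoin_induction with
    | mem H hH =>
      rcases hH with ⟨f, hf, rfl⟩ | ⟨f, hf, rfl⟩
      · exact Algebra.subset_adjoin (Or.inr ⟨f, hf, rfl⟩)
      · exact Algebra.subset_adjoin (Or.inl ⟨f, hf, rfl⟩)
    | algebraMap r => exact (A.prodCoord A.toAffineVariety).algebraMap_mem r
    | add _ _ _ _ h h' => exact (A.prodCoord A.toAffineVariety).add_mem h h'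
    | mul _ _ _ _ h h' => exact (A.prodCoord A.toAffineVariety).mul_mem h h'
  have const : ∀ (c : K) (F : A.unitsCoord), (∀ g, (F : Mˣ → K) g = c) → φ F = c := by
    intro c F hF
    have : F = algebraMap K A.unitsCoord c := Subtype.ext (funext hF)
    rw [this]
    exact φ.commutes c
  have hxy : x * y = 1 := A.eval_injective _ _ fun f hf => by
    rw [← key _ (A.mul_regular f hf)]
    exact const _ _ fun g => by simp
  have hyx : y * x = 1 := A.eval_injective _ _ fun f hf => by
    rw [← key _ (swap _ (A.mul_regular f hf))]
    exact const _ _ fun g => by simp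
  refine ⟨⟨x, y, hxy, hyx⟩, ?_⟩
  rintro ⟨F, hF⟩
  induction hF using Algebra.adjoin_induction with
  | mem F hF =>
    rcases hF with ⟨f, hf, rfl⟩ | ⟨f, hf, rfl⟩
    · exact hx ⟨f, hf⟩
    · exact hy ⟨f, hf⟩
  | algebraMap r => exact φ.commutes r
  | add u v hu hv h h' => exact (map_add φ ⟨u, hu⟩ ⟨v, hv⟩).trans (congrArg₂ (· + ·) h h')
  | mul u v hu hv h h' => exact (map_mul φ ⟨u, hu⟩ ⟨v, hv⟩).trans (congrArg₂ (· * ·) h h')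

/-- The unit group of an affine algebraic monoid, as an affine algebraic group. -/
def units (A : AffineMonoid K M) : AffineGroup K Mˣ where
  coord := A.unitsCoord
  fg := A.unitsCoord_fg
  eval_injective g h hgh := Units.ext <| A.eval_injective _ _ fun f hf =>
    hgh _ (Algebra.subset_adjoin (Or.inl ⟨f, hf, rfl⟩))
  eval_surjective := A.exists_unit_of_algHom
  mul_regular _ hf := A.mul_mem_of_mem_unitsCoord
    (fun F hF => ⟨Algebra.subset_adjoin (Or.inl ⟨F, hF, rfl⟩),
      Algebra.subset_adjoin (Or.inr ⟨F, hF, rfl⟩)⟩) hf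
  inv_regular F hF := by
    induction hF using Algebra.adjoin_induction with
    | mem F hF =>
      rcases hF with ⟨f, hf, rfl⟩ | ⟨f, hf, rfl⟩
      · exact Algebra.subset_adjoin (Or.inr ⟨f, hf, rfl⟩)
      · exact Algebra.subset_adjoin (Or.inl ⟨f, hf, by simp⟩)
    | algebraMap r => exact A.unitsCoord.algebraMap_mem r
    | add _ _ _ _ h h' => exact A.unitsCoord.add_mem h h'
    | mul _ _ _ _ h h' => exact A.unitsCoord.mul_mem h h'

end AffineMonoid

namespace AffineGroup

variable {K : Type*} [Field K] {G : Type*} [Group G]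

/-- Right translation `(ρ_g f)(x) = f (x g)` of functions on `G`. -/
def rightTranslation (K : Type*) [Field K] {G : Type*} [Group G] (g : G) :
    Module.End K (G → K) :=
  LinearMap.funLeft K K (fun x => x * g)

/-- `g` is unipotent: right translation by `g` is a locally unipotent operator on the coordinate
algebra, that is, `ρ_g - 1` is locally nilpotent. -/
def IsUnipotent (A : AffineGroup K G) (g : G) : Prop :=
  ∀ f ∈ A.coord, ∃ n : ℕ, ((rightTranslation K g - 1) ^ n) f = 0

/-- Closed connected subgroups. -/
def IsClosedConnected (A : AffineGroup K G) (H : Subgroup G) : Prop :=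
  IsClosed[A.zariski] (H : Set G) ∧ @IsConnected G A.zariski (H : Set G)

/-- A connected reductive group: `G` is connected and its unipotent radical is trivial, i.e. the
only closed connected normal subgroup consisting of unipotent elements is the trivial one. -/
def IsConnectedReductive (A : AffineGroup K G) : Prop :=
  @IsConnected G A.zariski Set.univ ∧
    ∀ U : Subgroup G, A.IsClosedConnected U → U.Normal → (∀ u ∈ U, A.IsUnipotent u) → U = ⊥

/-- A Borel subgroup: a maximal closed connected solvable subgroup. -/
def IsBorel (A : AffineGroup K G) (B : Subgroup G) : Prop :=
  Maximal (fun H : Subgroup G => A.IsClosedConnected H ∧ Group.IsSolvable H) B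

end AffineGroup

namespace AffineMonoid

variable {K : Type*} [Field K] {M : Type*}

/-- A reductive monoid: an irreducible affine algebraic monoid whose unit group is a connected
reductive group. -/
def IsReductive [Monoid M] (A : AffineMonoid K M) : Prop :=
  @IsIrreducible M A.zariski Set.univ ∧ A.units.IsConnectedReductive

/-- The closure in `M` of a subgroup of the unit group; for a Borel subgroup `B` this is the
Borel submonoid determined by `B`. -/
def closureOf [Monoid M] (A : AffineMonoid K M) (B : Subgroup Mˣ) : Set M :=
  closure[A.zariski] ((fun g : Mˣ => (g : M)) '' (B : Set Mˣ))

/-- The set of nilpotent elements of the closure of `B`. -/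
def nilpotentPart [MonoidWithZero M] (A : AffineMonoid K M) (B : Subgroup Mˣ) : Set M :=
  {x | x ∈ A.closureOf B ∧ ∃ m : ℕ, 0 < m ∧ x ^ m = 0}

/-- An algebraic subsemigroup of `M`: a Zariski-closed subset that is stable under
multiplication. -/
def IsAlgebraicSubsemigroup [Monoid M] (A : AffineMonoid K M) (S : Set M) : Prop :=
  IsClosed[A.zariski] S ∧ ∀ x ∈ S, ∀ y ∈ S, x * y ∈ S

/-- Stability under the action `(b₁, b₂) · x = b₁ x b₂⁻¹` of `B × B` on `M`. -/
def IsBiStable [Monoid M] (B : Subgroup Mˣ) (S : Set M) : Prop :=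
  ∀ b₁ ∈ B, ∀ b₂ ∈ B, ∀ x ∈ S, (b₁ : M) * x * ((b₂⁻¹ : Mˣ) : M) ∈ S

end AffineMonoid

/-!
Suppose that `B` is connected and solvable. The right translates of generators of the coordinate
ring, normalized to vanish at `0`, span a finite-dimensional rational representation `ρ` of `M` on a
space `V` such that `ρ x = 0` only for `x = 0`. By the Lie–Kolchin theorem the operators `ρ b`,
`b ∈ B`, have a common complete flag of invariant subspaces, and so have the operators `ρ x` for `x`
in the closure of `B`, because it is a Zariski closed condition on `x` to leave a given subspace
invariant. Hence a product of elements of this closure with a nilpotent factor is nilpotent: a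
nilpotent triangular matrix is strictly triangular. Finally `x` is nilpotent if and only if
`x ^ dim V = 0`, which is a Zariski closed condition.
-/

section LieKolchin

open scoped commutatorElement

/-- A group with a topology for which the one-variable maps `x ↦ g * x`, `x ↦ x * g` and
`x ↦ ⁅g, x⁆` are continuous. Linear algebraic groups with their Zariski topology have this property,
although they are not topological groups: their multiplication is not jointly continuous for the
product topology. -/
class ContinuousCommutator (Γ : Type*) [Group Γ] [TopologicalSpace Γ] : Prop
    extends SeparatelyContinuousMul Γ where
  continuous_commutator : ∀ g : Γ, Continuous fun x : Γ => ⁅g, x⁆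

theorem eq_of_finite_range_of_isClosed_fiber {X Y : Type*} [TopologicalSpace X]
    [PreconnectedSpace X] {f : X → Y} (hfin : (Set.range f).Finite)
    (hf : ∀ y, IsClosed {x | f x = y}) (x x' : X) : f x = f x' := by
  refine IsLocallyConstant.apply_eq_of_preconnectedSpace
    (IsLocallyConstant.iff_isOpen_fiber.2 fun y => ?_) x x'
  have hcompl : (f ⁻¹' {y})ᶜ = ⋃ z ∈ Set.range f \ {y}, {x | f x = z} := by
    ext x
    simp
  rw [← isClosed_compl_iff, hcompl]
  exact hfin.sdiff.isClosed_biUnion fun z _ => hf z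

section Topology

variable {Γ : Type*} [Group Γ] [TopologicalSpace Γ]

theorem isPreconnected_subgroupClosure [SeparatelyContinuousMul Γ] {S : Set Γ}
    (hS : ∀ s ∈ S, ∃ T ⊆ (Subgroup.closure S : Set Γ), IsPreconnected T ∧ 1 ∈ T ∧ s ∈ T) :
    IsPreconnected (Subgroup.closure S : Set Γ) := by
  have translate {x : Γ} (hx : x ∈ Subgroup.closure S) {T : Set Γ}
      (hT : T ⊆ Subgroup.closure S) (hconn : IsPreconnected T) :
      (x * ·) '' T ⊆ Subgroup.closure S ∧ IsPreconnected ((x * ·) '' T) :=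
    ⟨Set.image_subset_iff.2 fun t ht => mul_mem hx (hT ht),
      hconn.image _ (continuous_const_mul x).continuousOn⟩
  refine isPreconnected_of_forall 1 fun y hy => ?_
  induction hy using Subgroup.closure_induction_right with
  | one => exact ⟨{1}, by simp, rfl, rfl, isPreconnected_singleton⟩
  | mul_right x hx s hs ih =>
    obtain ⟨U, hU, h1U, hxU, hUconn⟩ := ih
    obtain ⟨T, hT, hTconn, h1T, hsT⟩ := hS s hs
    obtain ⟨hxT, hxTconn⟩ := translate hx hT hTconn
    exact ⟨_, Set.union_subset hU hxT, .inl h1U, .inr ⟨s, hsT, rfl⟩,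
      hUconn.union x hxU ⟨1, h1T, mul_one x⟩ hxTconn⟩
  | mul_inv_cancel x hx s hs ih =>
    obtain ⟨U, hU, h1U, hxU, hUconn⟩ := ih
    obtain ⟨T, hT, hTconn, h1T, hsT⟩ := hS s hs
    obtain ⟨hxT, hxTconn⟩ :=
      translate (mul_mem hx (inv_mem (Subgroup.subset_closure hs))) hT hTconn
    exact ⟨_, Set.union_subset hU hxT, .inl h1U, .inr ⟨1, h1T, mul_one _⟩,
      hUconn.union x hxU ⟨s, hsT, inv_mul_cancel_right x s⟩ hxTconn⟩

variable [ContinuousCommutator Γ]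

theorem continuous_mul_mul_inv (h : Γ) : Continuous fun g : Γ => g * h * g⁻¹ := by
  have : (fun g : Γ => g * h * g⁻¹) = fun g => h * ⁅h⁻¹, g⁆ := by
    ext g
    simp [commutatorElement_def, mul_assoc]
  rw [this]
  exact (continuous_const_mul h).comp (ContinuousCommutator.continuous_commutator h⁻¹)

instance (H : Subgroup Γ) : ContinuousCommutator H where
  continuous_const_mul {a} :=
    ((continuous_const_mul (a : Γ)).comp continuous_subtype_val).subtype_mk _
  continuous_mul_const {a} :=
    ((continuous_mul_const (a : Γ)).comp continuous_subtype_val).subtype_mk _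
  continuous_commutator g :=
    ((ContinuousCommutator.continuous_commutator (g : Γ)).comp continuous_subtype_val).subtype_mk _

instance [PreconnectedSpace Γ] : PreconnectedSpace (commutator Γ) := by
  refine isPreconnected_iff_preconnectedSpace.1 ?_
  rw [commutator_eq_closure]
  refine isPreconnected_subgroupClosure ?_
  rintro _ ⟨g, h, rfl⟩
  refine ⟨Set.range fun x => ⁅g, x⁆, ?_, ?_, ⟨1, commutatorElement_one_right g⟩, ⟨h, rfl⟩⟩
  · rintro _ ⟨x, rfl⟩
    exact Subgroup.subset_closure ⟨g, x, rfl⟩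
  · exact isPreconnected_range (ContinuousCommutator.continuous_commutator g)

end Topology

section Representation

variable {K Γ V : Type*} [Field K] [Group Γ] [AddCommGroup V] [Module K V]

theorem exists_isIrreducible_toRepresentation {S : Type*} [Monoid S] [Nontrivial V]
    [FiniteDimensional K V] (ρ : Representation K S V) :
    ∃ σ : Subrepresentation ρ, σ.toRepresentation.IsIrreducible := by
  obtain ⟨σ, hσ, hmin⟩ := (InvImage.wf (Subrepresentation.toSubmodule (ρ := ρ))
    wellFounded_lt).has_min {σ | σ.toSubmodule ≠ ⊥} ⟨⊤, top_ne_bot (α := Submodule K V)⟩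
  have : Nontrivial σ.toSubmodule := Submodule.nontrivial_iff_ne_bot.2 hσ
  refine ⟨σ, { exists_pair_ne := ⟨⊥, ⊤, fun h => ?_⟩, eq_bot_or_eq_top := fun U => ?_ }⟩
  · exact bot_ne_top (α := Submodule K σ.toSubmodule) (congrArg Subrepresentation.toSubmodule h)
  · let U' : Subrepresentation ρ :=
      { toSubmodule := U.toSubmodule.map σ.toSubmodule.subtype
        apply_mem_toSubmodule := by
          rintro g _ ⟨u, hu, rfl⟩
          exact ⟨_, U.apply_mem_toSubmodule g hu, rfl⟩ }
    have hinj := Submodule.map_injective_of_injective σ.toSubmodule.subtype_injective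
    by_cases hU : U.toSubmodule = ⊥
    · exact .inl (Subrepresentation.toSubmodule_injective hU)
    · have hU' : U'.toSubmodule ≠ ⊥ := by
        simpa only [U', Submodule.map_bot] using hinj.ne hU
      have hle : U'.toSubmodule ≤ σ.toSubmodule := Submodule.map_subtype_le _ _
      have heq : U'.toSubmodule = σ.toSubmodule := hle.eq_of_not_lt (hmin U' hU')
      refine .inr (Subrepresentation.toSubmodule_injective ?_)
      exact hinj (heq.trans (Submodule.map_subtype_top _).symm)

theorem exists_eq_algebraMap_of_commute [IsAlgClosed K] {S : Type*} [Monoid S]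
    [FiniteDimensional K V] {ρ : Representation K S V} (hirr : ρ.IsIrreducible)
    (hcomm : ∀ g h, Commute (ρ g) (ρ h)) (g : S) : ∃ c : K, ρ g = algebraMap K _ c := by
  have hschur :=
    Representation.IsIrreducible.algebraMap_intertwiningMap_bijective_of_isAlgClosed (ρ := ρ)
  obtain ⟨c, hc⟩ := hschur.2 (LinearMap.intertwiningMap_of_isIntertwiningMap ρ ρ (ρ g)
    fun h v => LinearMap.congr_fun (hcomm g h).eq v)
  exact ⟨c, LinearMap.ext fun v => (congrArg (fun f => f v) hc).symm⟩

variable [TopologicalSpace Γ]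

/-- The matrix coefficients of `ρ` have closed level sets. This is the substitute for the continuity
of `ρ` that is available when `K` carries no topology. -/
def HasClosedCoefficients (ρ : Representation K Γ V) : Prop :=
  ∀ (v : V) (l : Module.Dual K V) (c : K), IsClosed {g | l (ρ g v) = c}

namespace HasClosedCoefficients

variable {ρ : Representation K Γ V}

theorem comp_subtype (hρ : HasClosedCoefficients ρ) (H : Subgroup Γ) :
    HasClosedCoefficients (ρ.comp H.subtype) :=
  fun v l c => (hρ v l c).preimage continuous_subtype_val

theorem toRepresentation (hρ : HasClosedCoefficients ρ) (σ : Subrepresentation ρ) :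
    HasClosedCoefficients σ.toRepresentation := by
  intro v l c
  obtain ⟨l', rfl⟩ := LinearMap.exists_extend l
  exact hρ v l' c

theorem quotient (hρ : HasClosedCoefficients ρ) {W : Submodule K V}
    (hW : ∀ g, W ≤ W.comap (ρ g)) : HasClosedCoefficients (ρ.quotient W hW) := by
  intro v l c
  obtain ⟨v, rfl⟩ := W.mkQ_surjective v
  exact hρ v (l ∘ₗ W.mkQ) c

theorem isClosed_character_eq (hρ : HasClosedCoefficients ρ) {H : Subgroup Γ} {χ : H → K}
    {v : V} (hv : v ≠ 0) (hχ : ∀ h : H, ρ h v = χ h • v) (c : K) : IsClosed {h | χ h = c} := by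
  obtain ⟨l, hl⟩ := Module.Projective.exists_dual_eq_one K hv
  convert hρ.comp_subtype H v l c using 3 with h
  simp [hχ, hl]

variable [ContinuousCommutator Γ] [PreconnectedSpace Γ] [FiniteDimensional K V]

theorem character_conjNormal (hρ : HasClosedCoefficients ρ) {N : Subgroup Γ} [N.Normal]
    {χ : N → K} {v : V} (hv : v ≠ 0) (hχ : ∀ h : N, ρ h v = χ h • v) (g : Γ) (h : N) :
    χ (MulAut.conjNormal g h) = χ h := by
  -- The values `χ (g * h * g⁻¹)` are eigenvalues of `ρ h`.
  have hfin : (Set.range fun g => χ (MulAut.conjNormal g h)).Finite := by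
    refine (Module.End.finite_hasEigenvalue (ρ h)).subset ?_
    rintro _ ⟨g, rfl⟩
    refine Module.End.hasEigenvalue_of_hasEigenvector (x := ρ g⁻¹ v)
      ⟨Module.End.mem_eigenspace_iff.2 ?_, ?_⟩
    · rw [← map_smul, ← hχ, MulAut.conjNormal_apply, ← Module.End.mul_apply,
        ← Module.End.mul_apply, ← map_mul, ← map_mul]
      group
    · exact (map_ne_zero_iff _ (ρ.apply_bijective g⁻¹).1).2 hv
  have hcont : Continuous fun g => (MulAut.conjNormal g h : N) :=
    Continuous.subtype_mk (continuous_mul_mul_inv (h : Γ)) _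
  simpa using eq_of_finite_range_of_isClosed_fiber hfin
    (fun c => (hρ.isClosed_character_eq hv hχ c).preimage hcont) g 1

theorem eq_algebraMap_of_isIrreducible (hρ : HasClosedCoefficients ρ) (hirr : ρ.IsIrreducible)
    {N : Subgroup Γ} [N.Normal] {χ : N → K} {v : V} (hv : v ≠ 0)
    (hχ : ∀ h : N, ρ h v = χ h • v) (h : N) : ρ h = algebraMap K _ (χ h) := by
  let σ : Subrepresentation ρ :=
    { toSubmodule := ⨅ h : N, Module.End.eigenspace (ρ h) (χ h)
      apply_mem_toSubmodule := fun g w hw => by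
        rw [Submodule.mem_iInf] at hw ⊢
        intro h
        have hmul : (h : Γ) * g = g * (MulAut.conjNormal g⁻¹ h : N) := by
          simp [mul_assoc]
        rw [Module.End.mem_eigenspace_iff, ← Module.End.mul_apply, ← map_mul, hmul, map_mul,
          Module.End.mul_apply, Module.End.mem_eigenspace_iff.1 (hw _), map_smul,
          hρ.character_conjNormal hv hχ] }
  have hvσ : v ∈ σ := (Submodule.mem_iInf _).2 fun h => Module.End.mem_eigenspace_iff.2 (hχ h)
  have hσ : σ = ⊤ := (eq_bot_or_eq_top σ).resolve_left fun hbot => hv (by rwa [hbot] at hvσ)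
  ext w
  have hw : w ∈ σ := hσ ▸ Submodule.mem_top (R := K) (x := w)
  exact Module.End.mem_eigenspace_iff.1 ((Submodule.mem_iInf _).1 hw h)

theorem eq_one_of_mem_commutator [Nontrivial V] (hρ : HasClosedCoefficients ρ)
    {χ : commutator Γ → K} (hχ : ∀ h : commutator Γ, ρ h = algebraMap K _ (χ h))
    (h : commutator Γ) : ρ h = 1 := by
  -- Elements of the commutator subgroup act with determinant `1`.
  have hpow (h : commutator Γ) : χ h ^ Module.finrank K V = 1 := by
    have hdet : LinearMap.det (ρ h) = 1 := congrArg Units.val (MonoidHom.mem_ker.1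
      (Abelianization.commutator_subset_ker (LinearMap.det.comp ρ).toHomUnits h.2))
    rw [hχ, Algebra.algebraMap_eq_smul_one, LinearMap.det_smul] at hdet
    simpa using hdet
  have hfin : (Set.range χ).Finite :=
    (Polynomial.nthRootsFinset (Module.finrank K V) (1 : K)).finite_toSet.subset <| by
      rintro _ ⟨h, rfl⟩
      exact (Polynomial.mem_nthRootsFinset Module.finrank_pos 1).2 (hpow h)
  obtain ⟨v, hv⟩ := exists_ne (0 : V)
  have hone : χ h = χ 1 := eq_of_finite_range_of_isClosed_fiber hfin
    (hρ.isClosed_character_eq hv fun h => by simp [hχ]) h 1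
  rw [hχ, hone, ← hχ, Subgroup.coe_one, map_one]

end HasClosedCoefficients

end Representation

theorem map_derivedSeries_commutator_le (Γ : Type*) [Group Γ] (n : ℕ) :
    (derivedSeries (commutator Γ) n).map (commutator Γ).subtype ≤ derivedSeries Γ (n + 1) := by
  induction n with
  | zero =>
    rw [derivedSeries_one]
    exact Subgroup.map_subtype_le _
  | succ n ih =>
    rw [derivedSeries_succ, derivedSeries_succ, Subgroup.map_commutator]
    exact Subgroup.commutator_mono ih ih

theorem exists_common_eigenvector_of_derivedSeries_eq_bot.{u, v, w} {K : Type u} [Field K]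
    [IsAlgClosed K] (n : ℕ) {Γ : Type v} [Group Γ] [TopologicalSpace Γ] [ContinuousCommutator Γ]
    [PreconnectedSpace Γ] (hn : derivedSeries Γ n = ⊥) {V : Type w} [AddCommGroup V] [Module K V]
    [Nontrivial V] [FiniteDimensional K V] {ρ : Representation K Γ V}
    (hρ : HasClosedCoefficients ρ) : ∃ v ≠ 0, ∀ g, ∃ c : K, ρ g v = c • v := by
  induction n generalizing Γ V with
  | zero =>
    obtain ⟨v, hv⟩ := exists_ne (0 : V)
    refine ⟨v, hv, fun g => ⟨1, ?_⟩⟩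
    have hg : g ∈ derivedSeries Γ 0 := Subgroup.mem_top g
    rw [hn, Subgroup.mem_bot] at hg
    simp [hg]
  | succ n ih =>
    obtain ⟨σ, hσ⟩ := exists_isIrreducible_toRepresentation ρ
    have hρσ := hρ.toRepresentation σ
    have : Nontrivial σ.toSubmodule := by
      by_contra hsub
      rw [not_nontrivial_iff_subsingleton] at hsub
      exact bot_ne_top (α := Subrepresentation σ.toRepresentation)
        (Subrepresentation.toSubmodule_injective (Subsingleton.elim _ _))
    have hn' : derivedSeries (commutator Γ) n = ⊥ :=
      (Subgroup.map_eq_bot_iff_of_injective _ (Subgroup.subtype_injective _)).1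
        (le_bot_iff.1 (hn ▸ map_derivedSeries_commutator_le Γ n))
    obtain ⟨u, hu, hχ⟩ := ih hn' (hρσ.comp_subtype (commutator Γ))
    choose χ hχ using hχ
    have htriv := hρσ.eq_one_of_mem_commutator (hρσ.eq_algebraMap_of_isIrreducible hσ hu hχ)
    have hcomm (g h : Γ) : Commute (σ.toRepresentation g) (σ.toRepresentation h) := by
      have hgh : g * h = ⁅g, h⁆ * (h * g) := by
        simp [commutatorElement_def, mul_assoc]
      rw [commute_iff_eq, ← map_mul, hgh, map_mul, htriv ⟨⁅g, h⁆, Subgroup.commutator_mem_commutator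
        (Subgroup.mem_top g) (Subgroup.mem_top h)⟩, one_mul, map_mul]
    refine ⟨u, Subtype.coe_ne_coe.2 hu, fun g => ?_⟩
    obtain ⟨c, hc⟩ := exists_eq_algebraMap_of_commute hσ hcomm g
    exact ⟨c, congrArg Subtype.val (LinearMap.congr_fun hc u)⟩

theorem exists_common_eigenvector_of_isSolvable {K Γ V : Type*} [Field K] [IsAlgClosed K] [Group Γ]
    [TopologicalSpace Γ] [ContinuousCommutator Γ] [PreconnectedSpace Γ] (hsol : Group.IsSolvable Γ)
    [AddCommGroup V] [Module K V] [Nontrivial V] [FiniteDimensional K V] {ρ : Representation K Γ V}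
    (hρ : HasClosedCoefficients ρ) : ∃ v ≠ 0, ∀ g, ∃ c : K, ρ g v = c • v :=
  let ⟨n, hn⟩ := hsol.solvable
  exists_common_eigenvector_of_derivedSeries_eq_bot n hn hρ

end LieKolchin

section Triangularizable

variable {K S V : Type*} [Field K] [Monoid S] [AddCommGroup V] [Module K V]

/-- Every proper invariant subspace is of codimension one in some invariant subspace. For
finite-dimensional `V` this says that the operators `ρ x` are simultaneously triangularizable:
starting from `⊥` one builds a complete flag of invariant subspaces. -/
def IsTriangularizable (ρ : Representation K S V) : Prop :=
  ∀ W ∈ ρ.invtSubmodule, W ≠ ⊤ → ∃ v ∉ W, W ⊔ K ∙ v ∈ ρ.invtSubmodule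

theorem mem_invtSubmodule_iff_forall_le_comap {ρ : Representation K S V} {W : Submodule K V} :
    W ∈ ρ.invtSubmodule ↔ ∀ g, W ≤ W.comap (ρ g) := by
  simp only [Representation.mem_invtSubmodule, Module.End.mem_invtSubmodule]

theorem HasClosedCoefficients.isTriangularizable {Γ : Type*} [IsAlgClosed K] [Group Γ]
    [TopologicalSpace Γ] [ContinuousCommutator Γ] [PreconnectedSpace Γ]
    (hsol : Group.IsSolvable Γ) [FiniteDimensional K V] {ρ : Representation K Γ V}
    (hρ : HasClosedCoefficients ρ) : IsTriangularizable ρ := by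
  intro W hW hne
  have hle := mem_invtSubmodule_iff_forall_le_comap.1 hW
  have : Nontrivial (V ⧸ W) := Submodule.Quotient.nontrivial_iff.2 hne
  obtain ⟨v, hv, heig⟩ := exists_common_eigenvector_of_isSolvable hsol (hρ.quotient hle)
  obtain ⟨v, rfl⟩ := W.mkQ_surjective v
  refine ⟨v, fun h => hv ((Submodule.Quotient.mk_eq_zero W).2 h),
    mem_invtSubmodule_iff_forall_le_comap.2 fun g =>
      sup_le ((hle g).trans (Submodule.comap_mono le_sup_left)) ?_⟩
  obtain ⟨c, hc⟩ := heig g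
  have hmem : ρ g v - c • v ∈ W := (Submodule.Quotient.eq W).1 hc
  rw [Submodule.span_singleton_le_iff_mem, Submodule.mem_comap, ← sub_add_cancel (ρ g v) (c • v)]
  exact add_mem (Submodule.mem_sup_left hmem)
    (Submodule.mem_sup_right (Submodule.smul_mem _ c (Submodule.mem_span_singleton_self v)))

theorem apply_mem_of_isNilpotent_of_mem_sup {f : Module.End K V} (hf : IsNilpotent f)
    {W : Submodule K V} (hW : W ≤ W.comap f) {v : V} (hv : v ∉ W) (hfv : f v ∈ W ⊔ K ∙ v) :
    f v ∈ W := by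
  obtain ⟨w, hw, u, hu, hfv⟩ := Submodule.mem_sup.1 hfv
  obtain ⟨c, rfl⟩ := Submodule.mem_span_singleton.1 hu
  have hpow (n : ℕ) : (f ^ n) v - c ^ n • v ∈ W := by
    induction n with
    | zero => simp
    | succ n ih =>
      have hstep : (f ^ (n + 1)) v - c ^ (n + 1) • v =
          f ((f ^ n) v - c ^ n • v) + c ^ n • w := by
        rw [pow_succ', Module.End.mul_apply, map_sub, map_smul, ← hfv, pow_succ, smul_add,
          smul_smul]
        abel
      rw [hstep]
      exact add_mem (hW ih) (W.smul_mem _ hw)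
  obtain ⟨n, hn⟩ := hf
  have hc : c = 0 := by
    by_contra hc
    refine hv ((W.smul_mem_iff (pow_ne_zero n hc)).1 ?_)
    simpa [hn] using hpow n
  simpa [← hfv, hc] using hw

theorem IsTriangularizable.isNilpotent_mul_mul [FiniteDimensional K V] {ρ : Representation K S V}
    (hρ : IsTriangularizable ρ) {x : S} (hx : IsNilpotent (ρ x)) (a b : S) :
    IsNilpotent (ρ (a * x * b)) := by
  set f := ρ (a * x * b) with hf
  -- If `f` is locally nilpotent on an invariant `W`, it is so on the next step `W ⊔ K ∙ v` of the
  -- flag, because `ρ x` maps `W ⊔ K ∙ v` into `W`.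
  let P : Set (Submodule K V) := {W | W ∈ ρ.invtSubmodule ∧ ∀ w ∈ W, ∃ n, (f ^ n) w = 0}
  obtain ⟨W, ⟨hW, hnil⟩, hmax⟩ := wellFounded_gt.has_min P
    ⟨⊥, Representation.invtSubmodule.bot_mem ρ, fun w hw => ⟨0, by simpa using hw⟩⟩
  rw [Module.End.isNilpotent_iff_of_finite]
  by_cases htop : W = ⊤
  · exact fun w => hnil w (htop ▸ Submodule.mem_top)
  obtain ⟨v, hv, hWv⟩ := hρ W hW htop
  refine absurd (left_lt_sup.2 (by simpa using hv)) (hmax (W ⊔ K ∙ v) ⟨hWv, fun w hw => ?_⟩)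
  have hle := mem_invtSubmodule_iff_forall_le_comap.1 hW
  have hvle := mem_invtSubmodule_iff_forall_le_comap.1 hWv
  have hxW : W ⊔ K ∙ v ≤ W.comap (ρ x) := sup_le (hle x) <|
    (Submodule.span_singleton_le_iff_mem _ _).2 <| apply_mem_of_isNilpotent_of_mem_sup hx (hle x) hv
      (hvle x (Submodule.mem_sup_right (Submodule.mem_span_singleton_self v)))
  have hfw : f w ∈ W := by
    rw [hf, map_mul, map_mul]
    exact hle a (hxW (hvle b hw))
  obtain ⟨n, hn⟩ := hnil (f w) hfw
  exact ⟨n + 1, by rwa [pow_succ, Module.End.mul_apply]⟩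

end Triangularizable

section Generated

variable {K S V : Type*} [CommSemiring K] [Monoid S] [AddCommMonoid V] [Module K V]

/-- The subrepresentation generated by a set of vectors. -/
def orbitSpan (ρ : Representation K S V) (T : Set V) : Subrepresentation ρ where
  toSubmodule := Submodule.span K (⋃ t : T, Set.range fun g => ρ g t)
  apply_mem_toSubmodule h v hv := by
    induction hv using Submodule.span_induction with
    | mem v hv =>
      obtain ⟨t, g, rfl⟩ := Set.mem_iUnion.1 hv
      exact Submodule.subset_span <| Set.mem_iUnion_of_mem t
        ⟨h * g, LinearMap.congr_fun (map_mul ρ h g) t⟩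
    | zero => simp
    | add v w _ _ hv hw => simpa using add_mem hv hw
    | smul c v _ hv => simpa using Submodule.smul_mem _ c hv

theorem apply_mem_orbitSpan (ρ : Representation K S V) {T : Set V} {t : V} (ht : t ∈ T) (g : S) :
    ρ g t ∈ (orbitSpan ρ T).toSubmodule :=
  Submodule.subset_span (Set.mem_iUnion_of_mem ⟨t, ht⟩ ⟨g, rfl⟩)

theorem orbitSpan_le {ρ : Representation K S V} {T : Set V} {W : Submodule K V}
    (h : ∀ t ∈ T, ∀ g, ρ g t ∈ W) : (orbitSpan ρ T).toSubmodule ≤ W := by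
  refine Submodule.span_le.2 (Set.iUnion_subset fun t => ?_)
  rintro _ ⟨g, rfl⟩
  exact h t t.2 g

/-- The representation of `M` on the functions on `M` by right translation. -/
def rightRegular (K M : Type*) [CommSemiring K] [Monoid M] : Representation K M (M → K) where
  toFun m := LinearMap.funLeft K K (· * m)
  map_one' := by
    ext
    simp [LinearMap.funLeft_apply]
  map_mul' m n := by
    ext
    simp [LinearMap.funLeft_apply, mul_assoc]

theorem rightRegular_apply {K M : Type*} [CommSemiring K] [Monoid M] (m : M) (f : M → K) :
    rightRegular K M m f = fun x => f (x * m) :=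
  rfl

end Generated

namespace AffineVariety

variable {K : Type*} [Field K] {X Y : Type*}

theorem isClosed_iff_exists_zeros (A : AffineVariety K X) {S : Set X} :
    IsClosed[A.zariski] S ↔ ∃ F : Set (X → K), F ⊆ A.coord ∧ S = zeros F := by
  let _ := A.zariski
  rw [← isOpen_compl_iff]
  change Sᶜᶜ ∈ {S | ∃ F : Set (X → K), F ⊆ A.coord ∧ S = zeros F} ↔ _
  rw [compl_compl]
  rfl

theorem isClosed_fiber (A : AffineVariety K X) {f : X → K} (hf : f ∈ A.coord) (c : K) :
    IsClosed[A.zariski] {x | f x = c} := by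
  refine A.isClosed_iff_exists_zeros.2 ⟨{f - algebraMap K (X → K) c}, ?_, ?_⟩
  · exact Set.singleton_subset_iff.2 (A.coord.sub_mem hf (A.coord.algebraMap_mem c))
  · ext x
    simp [zeros, sub_eq_zero]

theorem continuous_of_comp_mem (A : AffineVariety K X) (A' : AffineVariety K Y) {φ : X → Y}
    (hφ : ∀ f ∈ A'.coord, f ∘ φ ∈ A.coord) : @Continuous X Y A.zariski A'.zariski φ := by
  let _ := A.zariski
  let _ := A'.zariski
  refine continuous_iff_isClosed.2 fun S hS => ?_
  obtain ⟨F, hF, rfl⟩ := A'.isClosed_iff_exists_zeros.1 hS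
  refine A.isClosed_iff_exists_zeros.2 ⟨(fun f => f ∘ φ) '' F, ?_, ?_⟩
  · rintro _ ⟨f, hf, rfl⟩
    exact hφ f (hF hf)
  · ext x
    simp [zeros]

theorem isClosed_setOf_eq (A : AffineVariety K X) (A' : AffineVariety K Y) {φ ψ : X → Y}
    (hφ : ∀ f ∈ A'.coord, f ∘ φ ∈ A.coord) (hψ : ∀ f ∈ A'.coord, f ∘ ψ ∈ A.coord) :
    IsClosed[A.zariski] {x | φ x = ψ x} := by
  refine A.isClosed_iff_exists_zeros.2
    ⟨(fun f : Y → K => f ∘ φ - f ∘ ψ) '' A'.coord, ?_, ?_⟩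
  · rintro _ ⟨f, hf, rfl⟩
    exact A.coord.sub_mem (hφ f hf) (hψ f hf)
  · ext x
    simp only [zeros, Set.forall_mem_image, Pi.sub_apply, Function.comp_apply, sub_eq_zero,
      Set.mem_ofPred_eq]
    exact ⟨fun h _ _ => by rw [h], fun h => A'.eval_injective _ _ h⟩

theorem exists_eq_sum_mul (A : AffineVariety K X) (A' : AffineVariety K Y) {F : X × Y → K}
    (hF : F ∈ A.prodCoord A') : ∃ (ι : Type) (_ : Fintype ι) (f : ι → A.coord) (g : ι → A'.coord),
      ∀ x y, F (x, y) = ∑ i, (f i : X → K) x * (g i : Y → K) y := by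
  induction hF using Algebra.adjoin_induction with
  | mem F hF =>
    rcases hF with ⟨f, hf, rfl⟩ | ⟨g, hg, rfl⟩
    · exact ⟨Unit, inferInstance, fun _ => ⟨f, hf⟩, fun _ => 1, by simp⟩
    · exact ⟨Unit, inferInstance, fun _ => 1, fun _ => ⟨g, hg⟩, by simp⟩
  | algebraMap r => exact ⟨Unit, inferInstance, fun _ => algebraMap K _ r, fun _ => 1, by simp⟩
  | add F F' _ _ h h' =>
    obtain ⟨ι, _, f, g, h⟩ := h
    obtain ⟨κ, _, f', g', h'⟩ := h'
    exact ⟨ι ⊕ κ, inferInstance, Sum.elim f f', Sum.elim g g', by simp [h, h']⟩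
  | mul F F' _ _ h h' =>
    obtain ⟨ι, _, f, g, h⟩ := h
    obtain ⟨κ, _, f', g', h'⟩ := h'
    refine ⟨ι × κ, inferInstance, fun i => f i.1 * f' i.2, fun i => g i.1 * g' i.2, fun x y => ?_⟩
    simp [h, h', Finset.sum_mul_sum, Fintype.sum_prod_type, mul_mul_mul_comm]

theorem fg_span_slices (A : AffineVariety K X) (A' : AffineVariety K Y)
    {F : X × Y → K} (hF : F ∈ A.prodCoord A') :
    (Submodule.span K (Set.range fun y x => F (x, y))).FG := by
  obtain ⟨ι, _, f, g, h⟩ := A.exists_eq_sum_mul A' hF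
  refine (Submodule.fg_span (Set.finite_range fun i => (f i : X → K))).of_le
    (Submodule.span_le.2 ?_)
  rintro _ ⟨y, rfl⟩
  have hslice : (fun x => F (x, y)) = ∑ i, (g i : Y → K) y • (f i : X → K) := by
    ext x
    simp [h, mul_comm]
  simp only [hslice]
  exact sum_mem fun i _ => Submodule.smul_mem _ _ (Submodule.subset_span ⟨i, rfl⟩)

theorem dual_slice_mem (A : AffineVariety K X) (A' : AffineVariety K Y) {F : X × Y → K}
    (hF : F ∈ A.prodCoord A') (l : Module.Dual K (X → K)) :
    (fun y => l fun x => F (x, y)) ∈ A'.coord := by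
  obtain ⟨ι, _, f, g, h⟩ := A.exists_eq_sum_mul A' hF
  have hslice (y : Y) : (fun x => F (x, y)) = ∑ i, (g i : Y → K) y • (f i : X → K) := by
    ext x
    simp [h, mul_comm]
  have heq : (fun y => l fun x => F (x, y)) = ∑ i, l (f i) • (g i : Y → K) := by
    ext y
    simp [hslice, mul_comm]
  rw [heq]
  exact sum_mem fun i _ => A'.coord.smul_mem (g i).2 _

end AffineVariety

namespace AffineMonoid

section Monoid

variable {K : Type*} [Field K] {M : Type*} [Monoid M] (A : AffineMonoid K M)

theorem mul_comp_mem {X : Type*} {P : Subalgebra K (X → K)} {φ ψ : X → M}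
    (hφ : ∀ f ∈ A.coord, f ∘ φ ∈ P) (hψ : ∀ f ∈ A.coord, f ∘ ψ ∈ P) {f : M → K}
    (hf : f ∈ A.coord) : f ∘ (φ * ψ) ∈ P := by
  obtain ⟨ι, _, g, h, heq⟩ := A.exists_eq_sum_mul A.toAffineVariety (A.mul_regular f hf)
  have hsum : f ∘ (φ * ψ) = ∑ i, ((g i : M → K) ∘ φ) * ((h i : M → K) ∘ ψ) := by
    ext x
    simpa using heq (φ x) (ψ x)
  rw [hsum]
  exact sum_mem fun i _ => P.mul_mem (hφ _ (g i).2) (hψ _ (h i).2)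

theorem const_mul_comp_mem (a : M) {f : M → K} (hf : f ∈ A.coord) :
    f ∘ (fun x => a * x) ∈ A.coord :=
  A.mul_comp_mem (φ := fun _ => a) (ψ := id) (fun f _ => A.coord.algebraMap_mem (f a))
    (fun _ hf => hf) hf

theorem mul_const_comp_mem (a : M) {f : M → K} (hf : f ∈ A.coord) :
    f ∘ (fun x => x * a) ∈ A.coord :=
  A.mul_comp_mem (φ := id) (ψ := fun _ => a) (fun _ hf => hf)
    (fun f _ => A.coord.algebraMap_mem (f a)) hf

theorem pow_comp_mem (n : ℕ) {f : M → K} (hf : f ∈ A.coord) :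
    f ∘ (fun x => x ^ n) ∈ A.coord := by
  induction n generalizing f with
  | zero =>
    simp only [pow_zero]
    exact A.coord.algebraMap_mem (f 1)
  | succ n ih =>
    simp only [pow_succ]
    exact A.mul_comp_mem (φ := fun x => x ^ n) (ψ := id) (fun _ => ih) (fun _ hf => hf) hf

theorem separatelyContinuousMul : @SeparatelyContinuousMul M A.zariski _ :=
  let _ := A.zariski
  { continuous_const_mul := fun {a} =>
      A.continuous_of_comp_mem _ fun _ hf => A.const_mul_comp_mem a hf
    continuous_mul_const := fun {a} =>
      A.continuous_of_comp_mem _ fun _ hf => A.mul_const_comp_mem a hf }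

/-- The Zariski closure `A.closureOf B` of a subgroup `B` of the unit group, as a submonoid. -/
def closureSubmonoid (B : Subgroup Mˣ) : Submonoid M :=
  let _ := A.zariski
  let _ := A.separatelyContinuousMul
  (B.toSubmonoid.map (Units.coeHom M)).topologicalClosure

theorem coe_mem_closureSubmonoid {B : Subgroup Mˣ} {b : Mˣ} (hb : b ∈ B) :
    (b : M) ∈ A.closureSubmonoid B :=
  let _ := A.zariski
  subset_closure ⟨b, hb, rfl⟩

/-- A rational representation of an affine algebraic monoid: its matrix coefficients are regular
functions. -/
def IsRational {V : Type*} [AddCommGroup V] [Module K V] (ρ : Representation K M V) : Prop :=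
  ∀ (v : V) (l : Module.Dual K V), (fun x => l (ρ x v)) ∈ A.coord

variable {A} {V : Type*} [AddCommGroup V] [Module K V]

namespace IsRational

variable {ρ : Representation K M V}

theorem isClosed_setOf_apply_mem (hρ : A.IsRational ρ) (v : V) (W : Submodule K V) :
    IsClosed[A.zariski] {x | ρ x v ∈ W} := by
  let _ := A.zariski
  have h : {x | ρ x v ∈ W} = ⋂ l ∈ W.dualAnnihilator, {x | l (ρ x v) = 0} := by
    ext x
    simp only [Set.mem_ofPred_eq, Set.mem_iInter]
    exact (Subspace.forall_mem_dualAnnihilator_apply_eq_zero_iff W (ρ x v)).symm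
  rw [h]
  exact isClosed_biInter fun l _ => A.isClosed_fiber (hρ v l) 0

theorem mem_invtSubmodule_closure_iff (hρ : A.IsRational ρ) {B : Subgroup Mˣ} {W : Submodule K V} :
    W ∈ Representation.invtSubmodule (ρ.comp (A.closureSubmonoid B).subtype) ↔
      W ∈ Representation.invtSubmodule (ρ.comp ((Units.coeHom M).comp B.subtype)) := by
  let _ := A.zariski
  simp only [mem_invtSubmodule_iff_forall_le_comap]
  refine ⟨fun h b => h ⟨b.1, A.coe_mem_closureSubmonoid b.2⟩, fun h x w hw => ?_⟩
  refine closure_minimal ?_ (hρ.isClosed_setOf_apply_mem w W) x.2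
  rintro _ ⟨b, hb, rfl⟩
  exact h ⟨b, hb⟩ hw

theorem hasClosedCoefficients (hρ : A.IsRational ρ) :
    let _ := A.units.zariski
    HasClosedCoefficients (ρ.comp (Units.coeHom M)) :=
  fun v l => A.units.isClosed_fiber (Algebra.subset_adjoin (.inl ⟨_, hρ v l, rfl⟩))

end IsRational

theorem isRational_toRepresentation {σ : Subrepresentation (rightRegular K M)}
    (hσ : σ.toSubmodule ≤ Subalgebra.toSubmodule A.coord) : A.IsRational σ.toRepresentation := by
  intro f l
  obtain ⟨l', rfl⟩ := LinearMap.exists_extend l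
  exact A.dual_slice_mem _ (A.mul_regular f (hσ f.2)) l'

theorem fg_orbitSpan_rightRegular {S : Set (M → K)} (hfin : S.Finite) (hS : S ⊆ A.coord) :
    (orbitSpan (rightRegular K M) S).toSubmodule.FG := by
  have := hfin.to_subtype
  have h (f : S) := A.fg_span_slices A.toAffineVariety (A.mul_regular f (hS f.2))
  simpa only [orbitSpan, rightRegular_apply, Submodule.span_iUnion] using Submodule.fg_iSup _ h

end Monoid

section MonoidWithZero

variable {K : Type*} [Field K] {M : Type*} [MonoidWithZero M] (A : AffineMonoid K M)

theorem exists_isRational_apply_eq_zero_iff :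
    ∃ (V : Submodule K (M → K)) (ρ : Representation K M V),
      FiniteDimensional K V ∧ A.IsRational ρ ∧ ∀ x, ρ x = 0 ↔ x = 0 := by
  obtain ⟨S, hS⟩ := A.fg
  let S₀ : Set (M → K) := (fun s => s - algebraMap K (M → K) (s 0)) '' S
  have hS₀ : S₀ ⊆ A.coord := by
    rintro _ ⟨s, hs, rfl⟩
    exact A.coord.sub_mem (hS ▸ Algebra.subset_adjoin hs) (A.coord.algebraMap_mem _)
  let σ := orbitSpan (rightRegular K M) S₀
  have hcoord : σ.toSubmodule ≤ Subalgebra.toSubmodule A.coord :=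
    orbitSpan_le fun f hf m => A.mul_const_comp_mem m (hS₀ hf)
  have hzero : σ.toSubmodule ≤ LinearMap.ker (LinearMap.proj (R := K) (φ := fun _ : M => K) 0) := by
    refine orbitSpan_le ?_
    rintro _ ⟨s, -, rfl⟩ m
    simp [rightRegular_apply]
  refine ⟨_, σ.toRepresentation,
    .of_fg (A.fg_orbitSpan_rightRegular (S.finite_toSet.image _) hS₀),
    isRational_toRepresentation hcoord, fun x => ⟨fun hx => ?_, ?_⟩⟩
  · have hgen (s) (hs : s ∈ S) : s x = s 0 := by
      have hmem : s - algebraMap K (M → K) (s 0) ∈ S₀ := ⟨s, hs, rfl⟩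
      have h := LinearMap.congr_fun hx ⟨_, apply_mem_orbitSpan (rightRegular K M) hmem 1⟩
      have hval : rightRegular K M x (rightRegular K M 1 (s - algebraMap K (M → K) (s 0))) 1 = 0 :=
        congrFun (congrArg Subtype.val h) 1
      simpa [rightRegular_apply, sub_eq_zero] using hval
    refine A.eval_injective _ _ fun f hf => ?_
    have hev : Set.EqOn (Pi.evalAlgHom K (fun _ : M => K) x) (Pi.evalAlgHom K _ 0) S := hgen
    exact AlgHom.eqOn_adjoin_iff.2 hev (hS ▸ hf)
  · rintro rfl
    ext f y
    simpa [Subrepresentation.toRepresentation, rightRegular, LinearMap.funLeft_apply]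
      using hzero f.2

end MonoidWithZero

end AffineMonoid

theorem isNilpotent_apply_iff_of_apply_eq_zero_iff {S T F : Type*} [MonoidWithZero S]
    [MonoidWithZero T] [FunLike F S T] [MonoidHomClass F S T] {f : F}
    (hf : ∀ x, f x = 0 ↔ x = 0) {x : S} : IsNilpotent (f x) ↔ IsNilpotent x := by
  simp only [IsNilpotent, ← map_pow, hf]

theorem isNilpotent_iff_pow_finrank_eq_zero {K V : Type*} [Field K] [AddCommGroup V] [Module K V]
    [FiniteDimensional K V] {f : Module.End K V} :
    IsNilpotent f ↔ f ^ Module.finrank K V = 0 := by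
  refine ⟨fun h => ?_, fun h => ⟨_, h⟩⟩
  simpa [h.charpoly_eq_X_pow_finrank] using f.aeval_self_charpoly

theorem AffineGroup.continuousCommutator {K G : Type*} [Field K] [Group G] (A : AffineGroup K G) :
    @ContinuousCommutator G _ A.zariski :=
  let _ := A.zariski
  { A.separatelyContinuousMul with
    continuous_commutator := fun g => A.continuous_of_comp_mem _ fun _ hf =>
      A.mul_comp_mem (φ := fun x => g * x * g⁻¹) (ψ := fun x => x⁻¹)
        (fun _ hf => A.const_mul_comp_mem g (A.mul_const_comp_mem g⁻¹ hf)) A.inv_regular hf }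

namespace AffineMonoid

theorem IsRational.isTriangularizable_closure {K : Type*} [Field K] [IsAlgClosed K] {M : Type*}
    [Monoid M] {A : AffineMonoid K M} {V : Type*} [AddCommGroup V] [Module K V]
    [FiniteDimensional K V] {ρ : Representation K M V} (hρ : A.IsRational ρ) {B : Subgroup Mˣ}
    (hconn : @IsPreconnected Mˣ A.units.zariski B) (hsol : Group.IsSolvable B) :
    IsTriangularizable (ρ.comp (A.closureSubmonoid B).subtype) := by
  let _ := A.units.zariski
  have := A.units.continuousCommutator
  have : PreconnectedSpace B := isPreconnected_iff_preconnectedSpace.1 hconn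
  have hB := (hρ.hasClosedCoefficients.comp_subtype B).isTriangularizable hsol
  intro W hW hne
  obtain ⟨v, hv, hWv⟩ := hB W (hρ.mem_invtSubmodule_closure_iff.1 hW) hne
  exact ⟨v, hv, hρ.mem_invtSubmodule_closure_iff.2 hWv⟩

section Nilpotent

variable {K : Type*} [Field K] {M : Type*} [MonoidWithZero M] (A : AffineMonoid K M)

theorem isClosed_setOf_isNilpotent : IsClosed[A.zariski] {x : M | IsNilpotent x} := by
  obtain ⟨V, ρ, _, -, hker⟩ := A.exists_isRational_apply_eq_zero_iff
  have hset : {x : M | IsNilpotent x} = {x | x ^ Module.finrank K V = 0} := by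
    ext x
    rw [Set.mem_ofPred_eq, ← isNilpotent_apply_iff_of_apply_eq_zero_iff hker,
      isNilpotent_iff_pow_finrank_eq_zero, ← map_pow, hker, Set.mem_ofPred_eq]
  rw [hset]
  exact A.isClosed_setOf_eq _ (fun _ => A.pow_comp_mem _) fun f _ => A.coord.algebraMap_mem (f 0)

theorem mem_nilpotentPart_iff {B : Subgroup Mˣ} {x : M} :
    x ∈ A.nilpotentPart B ↔ x ∈ A.closureSubmonoid B ∧ IsNilpotent x :=
  and_congr_right fun _ => ⟨fun ⟨m, _, hm⟩ => ⟨m, hm⟩,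
    fun ⟨m, hm⟩ => ⟨m + 1, m.succ_pos, by rw [pow_succ, hm, zero_mul]⟩⟩

theorem isClosed_nilpotentPart (B : Subgroup Mˣ) : IsClosed[A.zariski] (A.nilpotentPart B) := by
  let _ := A.zariski
  have hset : A.nilpotentPart B = A.closureOf B ∩ {x | IsNilpotent x} :=
    Set.ext fun _ => A.mem_nilpotentPart_iff
  rw [hset]
  exact isClosed_closure.inter A.isClosed_setOf_isNilpotent

variable {A}

theorem mul_mul_mem_nilpotentPart [IsAlgClosed K] {B : Subgroup Mˣ}
    (hconn : @IsPreconnected Mˣ A.units.zariski B) (hsol : Group.IsSolvable B) {x a b : M}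
    (hx : x ∈ A.nilpotentPart B) (ha : a ∈ A.closureSubmonoid B) (hb : b ∈ A.closureSubmonoid B) :
    a * x * b ∈ A.nilpotentPart B := by
  obtain ⟨V, ρ, _, hρ, hker⟩ := A.exists_isRational_apply_eq_zero_iff
  obtain ⟨hxB, hnil⟩ := A.mem_nilpotentPart_iff.1 hx
  refine A.mem_nilpotentPart_iff.2 ⟨mul_mem (mul_mem ha hxB) hb, ?_⟩
  rw [← isNilpotent_apply_iff_of_apply_eq_zero_iff hker] at hnil ⊢
  exact (hρ.isTriangularizable_closure hconn hsol).isNilpotent_mul_mul (x := ⟨x, hxB⟩) hnil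
    ⟨a, ha⟩ ⟨b, hb⟩

end Nilpotent

end AffineMonoid

theorem corollary7p3_general {K : Type*} [Field K] [IsAlgClosed K] {M : Type*} [MonoidWithZero M]
    (A : AffineMonoid K M) {B : Subgroup Mˣ} (hconn : @IsPreconnected Mˣ A.units.zariski B)
    (hsol : Group.IsSolvable B) :
    A.IsAlgebraicSubsemigroup (A.nilpotentPart B) ∧
      AffineMonoid.IsBiStable B (A.nilpotentPart B) := by
  refine ⟨⟨A.isClosed_nilpotentPart B, fun x hx y hy => ?_⟩, fun b₁ hb₁ b₂ hb₂ x hx => ?_⟩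
  · simpa using AffineMonoid.mul_mul_mem_nilpotentPart hconn hsol hx (one_mem _)
      (A.mem_nilpotentPart_iff.1 hy).1
  · exact AffineMonoid.mul_mul_mem_nilpotentPart hconn hsol hx (A.coe_mem_closureSubmonoid hb₁)
      (A.coe_mem_closureSubmonoid (inv_mem hb₂))

theorem corollary7p3 {M : Type*} [MonoidWithZero M] (A : AffineMonoid ℂ M) (hM : A.IsReductive)
    (B : Subgroup Mˣ) (hB : A.units.IsBorel B) :
    A.IsAlgebraicSubsemigroup (A.nilpotentPart B) ∧
      AffineMonoid.IsBiStable B (A.nilpotentPart B) :=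
  corollary7p3_general A hB.1.1.2.2 hB.1.2
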